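/- Let $\mathcal K$ be a locally presentable abelian category. For a class $\mathcal F$ of objects of $\mathcal K$, let $\mathcal F^\perp$ be the class of all objects $B$ with $\operatorname{Ext}^1_{\mathcal K}(A,B)=0$ for all $A\in\mathcal F$; for a class $\mathcal C$ of objects, let ${}^\perp\mathcal C$ be the class of all objects $A$ with $\operatorname{Ext}^1_{\mathcal K}(A,B)=0$ for all $B\in\mathcal C$. An $\mathcal F$-monomorphism is a monomorphism whose cokernel lies in $\mathcal F$, and a $\mathcal C$-epimorphism is an epimorphism whose kernel lies in $\mathcal C$. Let $(\mathcal F,\mathcal C)$ be a complete cotorsion theory in $\mathcal K$. That is, $\mathcal C=\mathcal F^\perp$ and $\mathcal F={}^\perp\mathcal C$; for every object $X$ of $\mathcal K$ there is a $\mathcal C$-epimorphism $A\to X$ with $A\in\mathcal F$; and for every object $X$ there is an $\mathcal F$-monomorphism $X\to B$ with $B\in\mathcal C$. Suppose that $\mathcal F$ is strongly closed under directed colimits. That is, for every object $X$ of $\mathcal K$, the class of all objects $X\to Y$ of the comma category $X\downarrow\mathcal K$ that are $\mathcal F$-monomorphisms in $\mathcal K$ is closed under colimits in $X\downarrow\mathcal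 K$ of diagrams indexed by small nonempty directed posets. Then $\mathcal C$ is stably weakly reflective in $\mathcal K$, i.e. every object of $\mathcal K$ has a $\mathcal C$-envelope. That is, for every object $X$ of $\mathcal K$ there is a morphism $r\colon X\to X'$ with $X'\in\mathcal C$ such that every morphism $X\to Y$ with $Y\in\mathcal C$ factors (not necessarily uniquely) through $r$, and every endomorphism $h\colon X'\to X'$ with $hr=r$ is an isomorphism. -/

import Mathlib

open CategoryTheory CategoryTheory.Limits

universe w v u

namespace CotorsionTheory

section Reflections

variable {K : Type u} [Category.{v} K]

/-- `r : X ⟶ X'` is a weak reflection of `X` to the full subcategory on `A` (an `A`-preenvelope):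
`X'` lies in `A`, and every morphism from `X` to an object of `A` factors through `r`,
not necessarily uniquely. -/
structure IsWeakReflection (A : ObjectProperty K) {X X' : K} (r : X ⟶ X') : Prop where
  prop : A X'
  exists_fac : ∀ ⦃Y : K⦄, A Y → ∀ f : X ⟶ Y, ∃ g : X' ⟶ Y, r ≫ g = f

/-- `r : X ⟶ X'` is a stable weak reflection of `X` to `A` (an `A`-envelope): it is a weak
reflection, and every endomorphism `h` of `X'` with `r ≫ h = r` is an isomorphism. -/
structure IsStableWeakReflection (A : ObjectProperty K) {X X' : K} (r : X ⟶ X') : Prop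
    extends IsWeakReflection A r where
  isIso_of_comp_eq : ∀ h : X' ⟶ X', r ≫ h = r → IsIso h

/-- The full subcategory on `A` is stably weakly reflective in `K`:
every object of `K` has an `A`-envelope. -/
def IsStablyWeaklyReflective (A : ObjectProperty K) : Prop :=
  ∀ X : K, ∃ (X' : K) (r : X ⟶ X'), IsStableWeakReflection A r

end Reflections

section Abelian

variable {K : Type u} [Category.{v} K] [Abelian K]

/-- `Ext¹(A, B) = 0`. -/
def ExtOneVanishes (A B : K) : Prop :=
  letI : HasExt.{max u v} K := HasExt.standard K
  Subsingleton (Abelian.Ext.{max u v} A B 1)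

/-- The class `F^⊥` of all `B` with `Ext¹(A, B) = 0` for all `A` in `F`. -/
def rightPerp (F : ObjectProperty K) : ObjectProperty K :=
  fun B => ∀ A : K, F A → ExtOneVanishes A B

/-- The class `^⊥C` of all `A` with `Ext¹(A, B) = 0` for all `B` in `C`. -/
def leftPerp (C : ObjectProperty K) : ObjectProperty K :=
  fun A => ∀ B : K, C B → ExtOneVanishes A B

/-- `F`-monomorphisms: monomorphisms whose cokernel belongs to `F`. -/
def monoClass (F : ObjectProperty K) : MorphismProperty K :=
  fun _ _ f => Mono f ∧ F (cokernel f)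

/-- `C`-epimorphisms: epimorphisms whose kernel belongs to `C`. -/
def epiClass (C : ObjectProperty K) : MorphismProperty K :=
  fun _ _ f => Epi f ∧ C (kernel f)

/-- A pair of classes of objects `(F, C)` is a cotorsion theory. -/
structure IsCotorsionTheory (F C : ObjectProperty K) : Prop where
  right_eq : C = rightPerp F
  left_eq : F = leftPerp C

/-- A complete cotorsion theory: every object `X` has a special `F`-precover
(a `C`-epimorphism `A ⟶ X` with `A` in `F`) and a special `C`-preenvelope
(an `F`-monomorphism `X ⟶ B` with `B` in `C`). -/
structure IsCompleteCotorsionTheory (F C : ObjectProperty K) : Prop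
    extends IsCotorsionTheory F C where
  exists_special_precover : ∀ X : K, ∃ (A : K) (p : A ⟶ X), F A ∧ epiClass C p
  exists_special_preenvelope : ∀ X : K, ∃ (B : K) (i : X ⟶ B), C B ∧ monoClass F i

/-- The objects of the comma category `X ↓ K` which are `F`-monomorphisms `X ⟶ Y`. -/
def underMono (F : ObjectProperty K) (X : K) : ObjectProperty (Under X) :=
  fun Y => monoClass F Y.hom

/-- `F` is strongly closed under directed colimits: for each object `X`, the `F`-monomorphisms
out of `X` are closed in the comma category `X ↓ K` under colimits of (small) diagrams
indexed by nonempty directed posets. -/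
def IsStronglyClosedUnderDirectedColimits (F : ObjectProperty K) : Prop :=
  ∀ (X : K) (J : Type w) [PartialOrder J] [IsDirectedOrder J] [Nonempty J],
    (underMono F X).IsClosedUnderColimitsOfShape J

end Abelian

end CotorsionTheory

/-! Fix `X` and let `D` be the category of `F`-monomorphisms out of `X`; strong closure gives `D`
directed colimits. Morphisms from `X` to objects of `C` extend along `F`-monomorphisms because
`Ext¹` vanishes, so a special preenvelope is weakly terminal in `D`. An envelope is then a weakly
terminal object all of whose endomorphisms are isomorphisms; its target lies in `C` as a retract of
the preenvelope's.

Such an object exists because a chain longer than a given small set cannot keep enlarging a subset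
of it. This is used twice, on generalized elements with source in a small strong generator:
`exists_isWeaklyTerminal_forall_injective` makes all maps out of some weakly terminal object
injective, and `isIso_of_isWeaklyTerminal_of_forall_injective` makes its endomorphisms surjective.
-/

namespace CotorsionTheory

/-! ### Long transfinite chains stabilize -/

section Iteration

open SmallObject

variable {D : Type*} [Category* D]

/-- A category with colimits of shape all nonempty directed posets in `Type w`. -/
abbrev HasDirectedColimits (D : Type*) [Category* D] : Prop :=
  ∀ (J : Type w) [PartialOrder J] [IsDirectedOrder J] [Nonempty J], HasColimitsOfShape J D

lemma HasDirectedColimits.hasIterationOfShape (hD : HasDirectedColimits.{w} D)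
    (J : Type w) [LinearOrder J] [Nonempty J] : HasIterationOfShape J D where
  hasColimitsOfShape_of_isSuccLimit j hj := by
    have : Nonempty (Set.Iio j) := hj.nonempty_Iio.to_subtype
    exact hD (Set.Iio j)
  hasColimitsOfShape := hD J

lemma HasDirectedColimits.under (hD : HasDirectedColimits.{w} D) (X : D) :
    HasDirectedColimits.{w} (Under X) := fun J _ _ _ ↦ by
  have := hD J
  have : IsConnected J := IsFiltered.isConnected J
  infer_instance

lemma exists_regular_forall_not_injective (S : Type*) [Small.{w} S] :
    ∃ κ : Cardinal.{w}, κ.IsRegular ∧ ∀ f : κ.ord.ToType → S, ¬ Function.Injective f := by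
  refine ⟨Order.succ (max Cardinal.aleph0 (Cardinal.mk (Shrink.{w} S))),
    Cardinal.isRegular_succ (le_max_left _ _), fun f hf ↦ ?_⟩
  have h := Cardinal.mk_le_of_injective ((equivShrink.{w} S).injective.comp hf)
  rw [Cardinal.mk_ord_toType] at h
  exact (h.trans (le_max_right _ _)).not_gt (Order.lt_succ _)

/-- If every step from `j` to `next j` added an element, choosing one for each `j` would inject `J`
into `S`. -/
lemma exists_subset_of_monotone {J S : Type*} [LinearOrder J]
    (hJ : ∀ f : J → S, ¬ Function.Injective f) {s : J → Set S} (hs : Monotone s)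
    (next : J → J) (hnext : ∀ i j, i < j → next i ≤ j) :
    ∃ j, s (next j) ⊆ s j := by
  by_contra! h
  simp only [Set.not_subset] at h
  choose f hf hf' using h
  have key (i j : J) (hij : i < j) : f i ≠ f j := fun heq ↦
    hf' j (heq ▸ hs (hnext i j hij) (hf i))
  exact hJ f fun i j heq ↦ by
    by_contra hij
    exact (lt_or_gt_of_ne hij).elim (key i j · heq) (key j i · heq.symm)

/-- The iteration of a successor structure along a regular cardinal. -/
lemma exists_iteration (hD : HasDirectedColimits.{w} D) (Φ : SuccStruct D) (κ : Cardinal.{w})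
    (hκ : κ.IsRegular) :
    ∃ (F : κ.ord.ToType ⥤ D) (c : Cocone F), Nonempty (IsColimit c) ∧ Nonempty (Φ.X₀ ⟶ c.pt) ∧
      ∀ i, ∃ (i' : κ.ord.ToType) (f : i ⟶ i'), (∀ j, i < j → i' ≤ j) ∧ Φ.prop (F.map f) := by
  have : NoMaxOrder κ.ord.ToType := Cardinal.noMaxOrder hκ.aleph0_le
  have : Nonempty κ.ord.ToType := by
    rw [Ordinal.nonempty_toType_iff]
    simpa using hκ.pos.ne'
  let : OrderBot κ.ord.ToType := WellFoundedLT.toOrderBot _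
  let : SuccOrder κ.ord.ToType := SuccOrder.ofLinearWellFoundedLT _
  have := hD.hasIterationOfShape κ.ord.ToType
  exact ⟨_, Φ.iterationCocone κ.ord.ToType, ⟨Φ.isColimitIterationCocone _⟩,
    ⟨Φ.ιIteration κ.ord.ToType⟩, fun i ↦ ⟨_, _, fun _ ↦ Order.succ_le_of_lt,
      Φ.prop_iterationFunctor_map_succ i (not_isMax i)⟩⟩

/-- A sufficiently long iteration of a successor structure stabilizes, at some step, every
increasing family of subsets of a given small set. -/
lemma exists_iteration_stable (hD : HasDirectedColimits.{w} D) (Φ : SuccStruct D)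
    (S : Type*) [Small.{w} S] :
    ∃ L : D, ∀ s : (∀ Y : D, (Y ⟶ L) → Set S),
      (∀ ⦃Y Z : D⦄ (f : Y ⟶ Z) (g : Z ⟶ L), s Y (f ≫ g) ⊆ s Z g) →
      ∃ (Y : D) (g : Φ.succ Y ⟶ L), s _ g ⊆ s Y (Φ.toSucc Y ≫ g) := by
  obtain ⟨κ, hκ, hS⟩ := exists_regular_forall_not_injective.{w} S
  obtain ⟨F, c, -, -, h⟩ := exists_iteration hD Φ κ hκ
  choose next f hf hΦ using h
  refine ⟨c.pt, fun s hs ↦ ?_⟩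
  obtain ⟨j, hj⟩ := exists_subset_of_monotone hS (s := fun j ↦ s _ (c.ι.app j))
    (fun i j hij ↦ by
      have := hs (F.map (homOfLE hij)) (c.ι.app j)
      rwa [c.w] at this) next hf
  have key : ∀ {Y Z : D} (f : Y ⟶ Z), Φ.prop f → ∀ g : Z ⟶ c.pt,
      s _ g ⊆ s _ (f ≫ g) → ∃ (Y : D) (g : Φ.succ Y ⟶ c.pt),
        s _ g ⊆ s Y (Φ.toSucc Y ≫ g) := by
    rintro _ _ _ ⟨Y⟩ g h
    exact ⟨_, g, h⟩
  refine key _ (hΦ j) (c.ι.app (next j)) ?_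
  rwa [c.w]

end Iteration

/-! ### Weakly terminal objects with only invertible endomorphisms -/

section WeaklyTerminal

open SmallObject

variable {D : Type*} [Category* D] {K : Type u} [Category.{v} K]

/-- Every object of `D` admits a morphism to `T`. -/
def IsWeaklyTerminal (T : D) : Prop := ∀ Y : D, Nonempty (Y ⟶ T)

lemma IsWeaklyTerminal.of_hom {W T : D} (hW : IsWeaklyTerminal W) (f : W ⟶ T) :
    IsWeaklyTerminal T := fun Y ↦ ⟨(hW Y).some ≫ f⟩

/-- The pairs of generalized elements of `U.obj N`, with source in `P`, which are identified
by `f`. -/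
def kernelPairs (U : D ⥤ K) (P : ObjectProperty K) {N N' : D} (f : N ⟶ N') :
    Set (Σ p : Subtype P, (p.1 ⟶ U.obj N) × (p.1 ⟶ U.obj N)) :=
  {x | x.2.1 ≫ U.map f = x.2.2 ≫ U.map f}

lemma kernelPairs_subset_comp (U : D ⥤ K) (P : ObjectProperty K) {N N' N'' : D} (f : N ⟶ N')
    (g : N' ⟶ N'') : kernelPairs U P f ⊆ kernelPairs U P (f ≫ g) := fun x hx ↦ by
  simp only [kernelPairs, Set.mem_ofPred_eq, Functor.map_comp] at hx ⊢
  rw [reassoc_of% hx]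

variable [LocallySmall.{w} K] (hD : HasDirectedColimits.{w} D) (U : D ⥤ K)
  (P : ObjectProperty K) [ObjectProperty.Small.{w} P]

include hD

/-- Otherwise every object under `N` has a map that identifies more pairs of elements of `N`;
iterating these would enlarge a subset of a small set forever. -/
lemma exists_kernelPairs_maximal (N : D) :
    ∃ (N' : D) (f : N ⟶ N'), ∀ (N'' : D) (g : N' ⟶ N''),
      kernelPairs U P (f ≫ g) ⊆ kernelPairs U P f := by
  by_contra! h
  choose succ toSucc hsucc using h
  let Φ : SuccStruct (Under N) :=
    { X₀ := Under.mk (𝟙 N)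
      succ Y := Under.mk (Y.hom ≫ toSucc Y.right Y.hom)
      toSucc Y := Under.homMk (toSucc Y.right Y.hom) }
  have : Small.{w} (Subtype P) := inferInstanceAs (ObjectProperty.Small.{w} P)
  obtain ⟨L, hL⟩ := exists_iteration_stable (hD.under N) Φ
    (Σ p : Subtype P, (p.1 ⟶ U.obj N) × (p.1 ⟶ U.obj N))
  obtain ⟨Y, -, hY⟩ := hL (fun Y _ ↦ kernelPairs U P Y.hom) fun Y Z f _ ↦ by
    have := kernelPairs_subset_comp U P Y.hom f.right
    rwa [Under.w] at this
  exact hsucc Y.right Y.hom hY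

/-- Take the colimit of a `κ`-chain of maps given by `exists_kernelPairs_maximal`. By presentability
two elements of the colimit come from one stage; if a map out of the colimit identifies them,
maximality says the next step of the chain already did. -/
lemma exists_isWeaklyTerminal_forall_injective (κ : Cardinal.{w}) [Fact κ.IsRegular]
    [PreservesColimitsOfShape κ.ord.ToType U] (hP : P ≤ isCardinalPresentable K κ)
    {W : D} (hW : IsWeaklyTerminal W) :
    ∃ N : D, IsWeaklyTerminal N ∧ ∀ (N' : D) (f : N ⟶ N') (p : K), P p →
      Function.Injective fun a : p ⟶ U.obj N ↦ a ≫ U.map f := by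
  choose succ toSucc hsucc using exists_kernelPairs_maximal hD U P
  let Φ : SuccStruct D := { X₀ := W, succ := succ, toSucc := toSucc }
  obtain ⟨F, c, ⟨hc⟩, ⟨φ⟩, h⟩ := exists_iteration hD Φ κ Fact.out
  have key : ∀ {Y Z : D} (f : Y ⟶ Z), Φ.prop f → ∀ {N' : D} (g : Z ⟶ N'),
      kernelPairs U P (f ≫ g) ⊆ kernelPairs U P f := by
    rintro _ _ _ ⟨Y⟩ N' g
    exact hsucc _ N' g
  refine ⟨c.pt, hW.of_hom φ, fun N' f p hp a b hab ↦ ?_⟩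
  have : IsCardinalPresentable p κ := hP p hp
  have hc' : IsColimit (U.mapCocone c) := isColimitOfPreserves U hc
  have hpair : ∃ (i : κ.ord.ToType) (a' b' : p ⟶ U.obj (F.obj i)),
      a' ≫ U.map (c.ι.app i) = a ∧ b' ≫ U.map (c.ι.app i) = b := by
    obtain ⟨i, a', ha⟩ := IsCardinalPresentable.exists_hom_of_isColimit κ hc' a
    obtain ⟨j, b', hb⟩ := IsCardinalPresentable.exists_hom_of_isColimit κ hc' b
    refine ⟨max i j, a' ≫ U.map (F.map (homOfLE (le_max_left i j))),
      b' ≫ U.map (F.map (homOfLE (le_max_right i j))), ?_, ?_⟩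
    · rwa [Category.assoc, ← U.map_comp, c.w]
    · rwa [Category.assoc, ← U.map_comp, c.w]
  obtain ⟨i, a, b, rfl, rfl⟩ := hpair
  obtain ⟨j, m, -, hm⟩ := h i
  have hmem : a ≫ U.map (F.map m) = b ≫ U.map (F.map m) :=
    @key _ _ (F.map m) hm _ (c.ι.app j ≫ f) ⟨⟨p, hp⟩, a, b⟩ (by
      rw [kernelPairs, Set.mem_ofPred_eq, ← Category.assoc, c.w]
      simpa using hab)
  have hw : U.map (F.map m) ≫ U.map (c.ι.app j) = U.map (c.ι.app i) := by
    rw [← U.map_comp, c.w]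
  rw [← hw, reassoc_of% hmem]

lemma isIso_of_isWeaklyTerminal_of_forall_injective [U.ReflectsIsomorphisms]
    (hP : P.IsStrongGenerator) {N : D} (hN : IsWeaklyTerminal N)
    (hN' : ∀ (N' : D) (f : N ⟶ N') (p : K), P p →
      Function.Injective fun a : p ⟶ U.obj N ↦ a ≫ U.map f) (f : N ⟶ N) : IsIso f := by
  -- Every successor stage is `N`, entered through `f`, so stabilization of images constrains `f`.
  let Φ : SuccStruct D := { X₀ := N, succ _ := N, toSucc Y := (hN Y).some ≫ f }
  have : Small.{w} (Subtype P) := inferInstanceAs (ObjectProperty.Small.{w} P)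
  obtain ⟨L, hL⟩ := exists_iteration_stable hD Φ (Σ p : Subtype P, p.1 ⟶ U.obj N)
  obtain ⟨t⟩ := hN L
  -- The subsets are the images in `N` of the stages, along `t`. At a stable step, each element of
  -- `N` has the same image under `g ≫ t : N ⟶ N` as some element coming through `f`; injectivity of
  -- `g ≫ t` then lifts it along `f`.
  obtain ⟨Y, g, hY⟩ := hL (fun Y g ↦ {x | ∃ b : x.1.1 ⟶ U.obj Y, b ≫ U.map (g ≫ t) = x.2})
    (by
      rintro Y Z f g x ⟨b, hb⟩
      exact ⟨b ≫ U.map f, by simpa using hb⟩)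
  have : Mono (U.map f) := ⟨fun a b hab ↦ hP.isSeparating _ _ fun p hp h ↦
    hN' _ f p hp (by simp [hab])⟩
  have : IsIso (U.map f) := hP.isIso_of_mono _ fun p hp a ↦ by
    obtain ⟨b, hb⟩ := hY (show (⟨⟨p, hp⟩, a ≫ U.map (g ≫ t)⟩ : Σ p : Subtype P, p.1 ⟶ U.obj N) ∈ _
      from ⟨a, rfl⟩)
    refine ⟨b ≫ U.map (hN Y).some, hN' _ (g ≫ t) p hp ?_⟩
    simpa [Φ] using hb
  exact isIso_of_reflects_iso f U

omit [LocallySmall.{w} K] in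
/-- A category with directed colimits and a weakly terminal object has a weakly terminal object
all of whose endomorphisms are isomorphisms, if it admits a suitable functor to a locally
presentable category. -/
theorem exists_isWeaklyTerminal_forall_isIso (κ : Cardinal.{w}) [Fact κ.IsRegular]
    [IsCardinalLocallyPresentable K κ] [PreservesColimitsOfShape κ.ord.ToType U]
    [U.ReflectsIsomorphisms] {W : D} (hW : IsWeaklyTerminal W) :
    ∃ T : D, IsWeaklyTerminal T ∧ ∀ f : T ⟶ T, IsIso f := by
  obtain ⟨P, _, hP⟩ := HasCardinalFilteredGenerator.exists_small_generator K κ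
  obtain ⟨T, hT, hT'⟩ := exists_isWeaklyTerminal_forall_injective hD U P κ
    hP.le_isCardinalPresentable hW
  exact ⟨T, hT, isIso_of_isWeaklyTerminal_of_forall_injective hD U P hP.isStrongGenerator hT hT'⟩

end WeaklyTerminal

/-! ### Extension and retracts from vanishing `Ext¹` -/

section Abelian

variable {K : Type u} [Category.{v} K] [Abelian K]

lemma ExtOneVanishes.exists_comp_eq {X Y B : K} (i : X ⟶ Y) [Mono i]
    (h : ExtOneVanishes (cokernel i) B) (f : X ⟶ B) : ∃ g : Y ⟶ B, i ≫ g = f := by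
  let : HasExt.{max u v} K := HasExt.standard K
  have : Subsingleton (Abelian.Ext.{max u v} (cokernel i) B 1) := h
  have hS : (ShortComplex.mk i (cokernel.π i) (cokernel.condition i)).ShortExact :=
    { exact := ShortComplex.exact_cokernel i }
  obtain ⟨x, hx⟩ := Abelian.Ext.contravariant_sequence_exact₁ hS B (Abelian.Ext.mk₀ f)
    (add_zero 1) (Subsingleton.elim _ _)
  obtain ⟨g, rfl⟩ := (Abelian.Ext.mk₀_bijective _ _).2 x
  refine ⟨g, (Abelian.Ext.mk₀_bijective _ _).1 ?_⟩
  rwa [Abelian.Ext.mk₀_comp_mk₀] at hx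

lemma ExtOneVanishes.of_retract {A B T : K} (r : Retract T B) (h : ExtOneVanishes A B) :
    ExtOneVanishes A T := by
  let : HasExt.{max u v} K := HasExt.standard K
  have : Subsingleton (Abelian.Ext.{max u v} A B 1) := h
  refine (⟨fun x y ↦ ?_⟩ : Subsingleton (Abelian.Ext.{max u v} A T 1))
  have key (x : Abelian.Ext.{max u v} A T 1) :
      (x.comp (Abelian.Ext.mk₀ r.i) (add_zero 1)).comp (Abelian.Ext.mk₀ r.r) (add_zero 1) = x := by
    rw [Abelian.Ext.comp_assoc_of_third_deg_zero, Abelian.Ext.mk₀_comp_mk₀, r.retract,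
      Abelian.Ext.comp_mk₀_id]
  rw [← key x, ← key y, Subsingleton.elim (x.comp _ _) (y.comp _ _)]

lemma rightPerp_of_retract (F : ObjectProperty K) {B T : K} (r : Retract T B)
    (h : rightPerp F B) : rightPerp F T := fun A hA ↦ (h A hA).of_retract r

end Abelian

end CotorsionTheory

open CotorsionTheory

theorem mainTheorem5 {K : Type u} [CategoryTheory.Category.{v} K]
    [CategoryTheory.Abelian K] [CategoryTheory.IsLocallyPresentable.{w} K]
    (F C : CategoryTheory.ObjectProperty K)
    (hFC : CotorsionTheory.IsCompleteCotorsionTheory F C)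
    (hF : CotorsionTheory.IsStronglyClosedUnderDirectedColimits.{w} F) :
    CotorsionTheory.IsStablyWeaklyReflective C := by
  intro X
  obtain ⟨κ, _, _⟩ := IsLocallyPresentable.exists_cardinal.{w} K
  have hcolim : HasDirectedColimits.{w} (Under X) :=
    HasDirectedColimits.under (fun J _ _ _ ↦ inferInstance) X
  have hD : HasDirectedColimits.{w} (underMono F X).FullSubcategory := fun J _ _ _ ↦ by
    have := hcolim J
    have := hF X J
    infer_instance
  have hC {B : K} (hB : C B) : rightPerp F B := by rwa [hFC.right_eq] at hB
  obtain ⟨B, i, hB, hi⟩ := hFC.exists_special_preenvelope X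
  let W : (underMono F X).FullSubcategory := ⟨Under.mk i, hi⟩
  have hext {Y : (underMono F X).FullSubcategory} {Z : K} (hZ : C Z) (f : X ⟶ Z) :
      ∃ g : Y.obj.right ⟶ Z, Y.obj.hom ≫ g = f := by
    have := Y.property.1
    exact (hC hZ _ Y.property.2).exists_comp_eq Y.obj.hom f
  have hW : IsWeaklyTerminal W := fun Y ↦ by
    obtain ⟨g, hg⟩ := hext (Y := Y) hB i
    exact ⟨ObjectProperty.homMk (Under.homMk g hg)⟩
  have : Nonempty κ.ord.ToType := by
    rw [Ordinal.nonempty_toType_iff]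
    simpa using (Fact.out : κ.IsRegular).pos.ne'
  have := hcolim κ.ord.ToType
  have := hF X κ.ord.ToType
  have : IsConnected κ.ord.ToType := IsFiltered.isConnected _
  obtain ⟨T, hT, hT'⟩ := exists_isWeaklyTerminal_forall_isIso hD
    ((underMono F X).ι ⋙ Under.forget X) κ hW
  refine ⟨T.obj.right, T.obj.hom, ⟨⟨?_, fun Y hY f ↦ hext hY f⟩, fun h hh ↦ ?_⟩⟩
  · obtain ⟨a⟩ := hW T
    obtain ⟨b⟩ := hT W
    -- The endomorphism `a ≫ b` of `T` is invertible, so `T` is a retract of `W`.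
    have := hT' (a ≫ b)
    let r : Retract T W :=
      { i := a
        r := b ≫ inv (a ≫ b)
        retract := by rw [← Category.assoc, IsIso.hom_inv_id] }
    rw [hFC.right_eq]
    exact rightPerp_of_retract F (r.map ((underMono F X).ι ⋙ Under.forget X)) (hC hB)
  · have := hT' (ObjectProperty.homMk (Under.homMk h hh))
    exact inferInstanceAs (IsIso (((underMono F X).ι ⋙ Under.forget X).map
      (ObjectProperty.homMk (Under.homMk h hh) : T ⟶ T)))
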